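/- For an $n\times n$ complex Hermitian matrix $X$ let $\lambda^\downarrow(X)\in\mathbb{R}^n$ be the vector of its eigenvalues, counted with multiplicity and sorted in non-increasing order. For $x,y\in\mathbb{R}^n$ write $x\prec_w y$ if $\sum_{j=1}^k x_j\le\sum_{j=1}^k y_j$ for all $k=1,\dots,n$ (without rearranging the entries). For Hermitian $X,Y$ let $\delta(X;Y)\in\mathbb{R}^n$ be the vector determined by $$\sum_{j=1}^k\delta_j(X;Y)=\lim_{t\to0^+}\frac1t\Big(\sum_{j=1}^k\lambda_j^\downarrow(Y+tX)-\sum_{j=1}^k\lambda_j^\downarrow(Y)\Big),\qquad k=1,\dots,n$$ (these limits exist). Hermitian matrices $A$ and $B$ are called co-diagonal if there is an orthonormal basis of $\mathbb{C}^n$ in which both are diagonal and in which the diagonal entries of $A$ and the diagonal entries of $B$ both appear in non-increasing order. Let $A,B,C$ be $n\times n$ complex Hermitian matrices, with $A$ and $B$ co-diagonal. The following are equivalent: (i) $\lambda^\downarrow(aA+B)\prec_w\lambda^\downarrow(aA+C)$ for all $a\ge0$; (ii) $\delta(B;A)\prec_w\delta(C;A)$; (iii) $\delta(aA+B;A)\prec_w\delta(aA+C;A)$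 for all $a\ge0$. -/

import Mathlib

/-- The real vector space of `n × n` complex Hermitian matrices. -/
abbrev Herm (n : ℕ) : Type := selfAdjoint (Matrix (Fin n) (Fin n) ℂ)

namespace Herm

variable {n : ℕ}

/-- The operator on `ℂⁿ` (with its Euclidean inner product) given by a Hermitian matrix. -/
noncomputable def toLin (A : Herm n) :
    EuclideanSpace ℂ (Fin n) →ₗ[ℂ] EuclideanSpace ℂ (Fin n) :=
  Matrix.toEuclideanLin (A : Matrix (Fin n) (Fin n) ℂ)

theorem toLin_isSymmetric (A : Herm n) : A.toLin.IsSymmetric :=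
  Matrix.isSymmetric_toEuclideanLin_iff.mpr A.2

/-- `eigs A` is the vector `λ^↓(A)` of the eigenvalues of `A`, repeated according to multiplicity
and sorted in non-increasing order (Mathlib's `LinearMap.IsSymmetric.eigenvalues` is sorted so). -/
noncomputable def eigs (A : Herm n) : Fin n → ℝ :=
  A.toLin_isSymmetric.eigenvalues finrank_euclideanSpace_fin

end Herm

/-- The sum of the first `k` entries of a real vector of length `n` (for `k ≤ n`). -/
def headSum {n : ℕ} (x : Fin n → ℝ) (k : ℕ) : ℝ :=
  ∑ j : Fin n with j.val < k, x j

/-- The relation `x ≺_w y`, without any rearrangement of the entries: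
`∑_{j=1}^k x_j ≤ ∑_{j=1}^k y_j` for `k = 1, …, n`. -/
def WeakMaj {n : ℕ} (x y : Fin n → ℝ) : Prop :=
  ∀ k : ℕ, 1 ≤ k → k ≤ n → headSum x k ≤ headSum y k

namespace Herm

variable {n : ℕ}

/-- The right derivative at `t = 0` of the sum of the `k` largest eigenvalues of `A + t B`. -/
noncomputable def kyFanDeriv (B A : Herm n) (k : ℕ) : ℝ :=
  derivWithin (fun t : ℝ => headSum (eigs (A + t • B)) k) (Set.Ioi 0) 0

/-- The vector `δ(B; A)`, determined by
`∑_{j=1}^k δ_j(B; A) = (d/dt) ∑_{j=1}^k λ_j^↓(A + t B)` at `t = 0⁺`, for `k = 1, …, n`. That the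
derivative exists and that this identity holds is proved in `Herm.hasDerivWithinAt_headSum_delta`. -/
noncomputable def delta (B A : Herm n) : Fin n → ℝ :=
  fun j => kyFanDeriv B A (j + 1) - kyFanDeriv B A j

/-- `A` and `B` are co-diagonal: there is an orthonormal basis of `ℂⁿ` (the columns of the unitary
matrix `U`) in which `A` and `B` are both diagonal, and in which the diagonal entries of `A` and
those of `B` both appear in non-increasing order. -/
def CoDiagonal (A B : Herm n) : Prop :=
  ∃ U ∈ Matrix.unitaryGroup (Fin n) ℂ, ∃ α β : Fin n → ℝ, Antitone α ∧ Antitone β ∧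
    star U * (A : Matrix (Fin n) (Fin n) ℂ) * U = Matrix.diagonal (fun i => (α i : ℂ)) ∧
    star U * (B : Matrix (Fin n) (Fin n) ℂ) * U = Matrix.diagonal (fun i => (β i : ℂ))

/-! `delta` is well defined: existence of the right derivatives. -/

theorem headSum_weights_le {l c : Fin n → ℝ} (hl : Antitone l) (h0 : ∀ i, 0 ≤ c i)
    (h1 : ∀ i, c i ≤ 1) (k : ℕ) (hc : ∑ i, c i = ∑ i : Fin n with i.val < k, (1 : ℝ)) :
    ∑ i, l i * c i ≤ headSum l k := by
  obtain ⟨m, hm⟩ : ∃ m : ℝ, ∀ i : Fin n,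
      l i * (c i - if (i : ℕ) < k then 1 else 0) ≤ m * (c i - if (i : ℕ) < k then 1 else 0) := by
    by_cases hk : k < n
    · refine ⟨l ⟨k, hk⟩, fun i => ?_⟩
      split_ifs with h
      · have : l ⟨k, hk⟩ ≤ l i := hl (Fin.le_def.mpr h.le)
        nlinarith [h1 i]
      · have : l i ≤ l ⟨k, hk⟩ := hl (Fin.le_def.mpr (not_lt.mp h))
        nlinarith [h0 i]
    · rcases Nat.eq_zero_or_pos n with rfl | hn
      · exact ⟨0, fun i => i.elim0⟩
      · refine ⟨l ⟨n - 1, by omega⟩, fun i => ?_⟩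
        have hi := i.2
        rw [if_pos (by omega)]
        have : l ⟨n - 1, by omega⟩ ≤ l i := hl (Fin.le_def.mpr (by simp; omega))
        nlinarith [h1 i]
  have hs := Finset.sum_le_sum fun i (_ : i ∈ Finset.univ) => hm i
  rw [← Finset.mul_sum, Finset.sum_sub_distrib, hc, Finset.sum_filter, sub_self, mul_zero] at hs
  simp only [mul_sub, Finset.sum_sub_distrib, mul_ite, mul_one, mul_zero] at hs
  rw [headSum, Finset.sum_filter]
  linarith

/-- Ky Fan: the quadratic form of `A`, summed over the first `k` vectors of an orthonormal basis,
is at most the sum of the `k` largest eigenvalues of `A`. -/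
theorem headSum_quadForm_le (A : Herm n)
    (v : OrthonormalBasis (Fin n) ℂ (EuclideanSpace ℂ (Fin n))) (k : ℕ) :
    headSum (fun j => (inner ℂ (v j) (A.toLin (v j))).re) k ≤ headSum A.eigs k := by
  set e := A.toLin_isSymmetric.eigenvectorBasis finrank_euclideanSpace_fin with he
  have hq : ∀ w, (inner ℂ w (A.toLin w)).re = ∑ i, A.eigs i * ‖inner ℂ (e i) w‖ ^ 2 := by
    intro w
    rw [← e.sum_inner_mul_inner w (A.toLin w), Complex.re_sum]
    refine Finset.sum_congr rfl fun i _ => ?_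
    rw [← A.toLin_isSymmetric (e i) w, he, A.toLin_isSymmetric.apply_eigenvectorBasis, ← he,
      inner_smul_left, ← inner_conj_symm w (e i), mul_left_comm, mul_comm (starRingEnd ℂ (inner ..)),
      Complex.mul_conj, Complex.normSq_eq_norm_sq]
    simp only [Complex.coe_algebraMap, Complex.conj_ofReal]
    rw [← Complex.ofReal_mul, Complex.ofReal_re]
    rfl
  have hv : ∀ i, ∑ j, ‖inner ℂ (e i) (v j)‖ ^ 2 = 1 := by
    intro i
    rw [v.sum_sq_norm_inner_left, e.norm_eq_one, one_pow]
  have hsum : headSum (fun j => (inner ℂ (v j) (A.toLin (v j))).re) k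
      = ∑ i, A.eigs i * ∑ j : Fin n with j.val < k, ‖inner ℂ (e i) (v j)‖ ^ 2 := by
    simp only [headSum, hq, Finset.mul_sum]
    exact Finset.sum_comm
  rw [hsum]
  refine headSum_weights_le (A.toLin_isSymmetric.eigenvalues_antitone _)
    (fun i => Finset.sum_nonneg fun j _ => by positivity) (fun i => ?_) k ?_
  · rw [← hv i]
    exact Finset.sum_le_sum_of_subset_of_nonneg (Finset.filter_subset _ _)
      fun j _ _ => by positivity
  · rw [Finset.sum_comm]
    refine Finset.sum_congr rfl fun j _ => ?_
    rw [e.sum_sq_norm_inner_right, v.norm_eq_one, one_pow]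

theorem headSum_eigs_convexOn (A B : Herm n) (k : ℕ) :
    ConvexOn ℝ Set.univ (fun t : ℝ => headSum (eigs (A + t • B)) k) := by
  refine ⟨convex_univ, fun x _ y _ a b ha hb hab => ?_⟩
  set X := A + x • B
  set Y := A + y • B
  have hZ : A + (a • x + b • y) • B = a • X + b • Y := by
    have : A = (a + b) • A := by rw [hab, one_smul]
    simp only [X, Y, smul_eq_mul]
    nth_rewrite 1 [this]
    module
  simp only [hZ]
  set Z := a • X + b • Y with hZd
  set v := Z.toLin_isSymmetric.eigenvectorBasis finrank_euclideanSpace_fin with hv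
  have hlin : ∀ w, Z.toLin w = (a : ℂ) • X.toLin w + (b : ℂ) • Y.toLin w := by
    intro w
    have : (Z : Matrix (Fin n) (Fin n) ℂ)
        = (a : ℂ) • (X : Matrix (Fin n) (Fin n) ℂ) + (b : ℂ) • (Y : Matrix (Fin n) (Fin n) ℂ) := by
      ext i j
      simp [hZd]
    simp only [toLin, this, map_add, map_smul, LinearMap.add_apply, LinearMap.smul_apply]
  have h : ∀ j, Z.eigs j = a * (inner ℂ (v j) (X.toLin (v j))).re
      + b * (inner ℂ (v j) (Y.toLin (v j))).re := by
    intro j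
    have h1 : (inner ℂ (v j) (Z.toLin (v j))).re = Z.eigs j := by
      rw [hv, Z.toLin_isSymmetric.apply_eigenvectorBasis, ← hv, inner_smul_right,
        inner_self_eq_norm_sq_to_K, v.norm_eq_one]
      simp [eigs]
    rw [← h1, hlin, inner_add_right, inner_smul_right, inner_smul_right, Complex.add_re,
      Complex.re_ofReal_mul, Complex.re_ofReal_mul]
  calc headSum Z.eigs k
      = a * headSum (fun j => (inner ℂ (v j) (X.toLin (v j))).re) k
        + b * headSum (fun j => (inner ℂ (v j) (Y.toLin (v j))).re) k := by
        simp only [headSum, h, Finset.sum_add_distrib, Finset.mul_sum]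
    _ ≤ a • headSum X.eigs k + b • headSum Y.eigs k :=
        add_le_add (mul_le_mul_of_nonneg_left (headSum_quadForm_le X v k) ha)
          (mul_le_mul_of_nonneg_left (headSum_quadForm_le Y v k) hb)

theorem headSum_delta (B A : Herm n) {k : ℕ} (hk : k ≤ n) :
    headSum (delta B A) k = kyFanDeriv B A k := by
  induction k with
  | zero => simp [headSum, kyFanDeriv]
  | succ k ih =>
    have : (Finset.univ.filter fun j : Fin n => (j : ℕ) < k + 1)
        = insert ⟨k, hk⟩ (Finset.univ.filter fun j : Fin n => (j : ℕ) < k) := by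
      ext j
      simp [Fin.ext_iff]
      omega
    have ih' := ih (by omega)
    rw [headSum] at ih' ⊢
    rw [this, Finset.sum_insert (by simp), ih']
    simp [delta]

/-- The defining property of `δ(B; A)`: the right derivative at `0` of the sum of the `k` largest
eigenvalues of `A + t B` exists and is the sum of the first `k` entries of `δ(B; A)`. -/
theorem hasDerivWithinAt_headSum_delta (B A : Herm n) {k : ℕ} (hk : k ≤ n) :
    HasDerivWithinAt (fun t : ℝ => headSum (eigs (A + t • B)) k)
      (headSum (delta B A) k) (Set.Ioi 0) 0 := by
  rw [headSum_delta B A hk]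
  exact ((headSum_eigs_convexOn A B k).differentiableWithinAt_Ioi_of_mem_interior
    (by simp)).hasDerivWithinAt

end Herm

namespace Herm

open Filter Topology

variable {n : ℕ}

/-! Let f be the sum of the k largest eigenvalues. By Ky Fan's principle f is sublinear, and on the
cone spanned by a co-diagonal pair it is additive (`CoDiagonal.headSum_eigs_smul_add`). Write f'(A;
X) for its right derivative at A along X. Additivity gives f'(A; B) = f(B), so (ii) reads f(B) ≤
f'(A; C). Sublinearity gives f'(A; C) ≤ f(aA + C) - a f(A), and adding a f(A) = f(aA + B) - f(B) to
(ii) yields (i). Conversely, (i) at a = 1/t compares the difference quotients at t, whose limits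
give (ii). For (iii), f'(A; aA + B) = a f(A) + f(B), while f'(A; aA + C) ≥ a f(A) + f'(A; C); taking
a = 0 returns (ii). -/

theorem headSum_add (x y : Fin n → ℝ) (k : ℕ) :
    headSum (fun j => x j + y j) k = headSum x k + headSum y k :=
  Finset.sum_add_distrib

theorem headSum_mul_left (c : ℝ) (x : Fin n → ℝ) (k : ℕ) :
    headSum (fun j => c * x j) k = c * headSum x k :=
  (Finset.mul_sum _ _ _).symm

/-- Ky Fan's inequality relative to an arbitrary ordered orthonormal eigenbasis. -/
theorem headSum_quadForm_le_of_eigenbasis (A : Herm n)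
    (e v : OrthonormalBasis (Fin n) ℂ (EuclideanSpace ℂ (Fin n))) {α : Fin n → ℝ}
    (hα : Antitone α) (hA : ∀ i, A.toLin (e i) = (α i : ℂ) • e i) (k : ℕ) :
    headSum (fun j => (inner ℂ (v j) (A.toLin (v j))).re) k ≤ headSum α k := by
  have hq : ∀ w, (inner ℂ w (A.toLin w)).re = ∑ i, α i * ‖inner ℂ (e i) w‖ ^ 2 := by
    intro w
    rw [← e.sum_inner_mul_inner w (A.toLin w), Complex.re_sum]
    refine Finset.sum_congr rfl fun i _ => ?_
    rw [← A.toLin_isSymmetric (e i) w, hA, inner_smul_left, ← inner_conj_symm w (e i),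
      mul_left_comm, mul_comm (starRingEnd ℂ (inner ..)), Complex.mul_conj,
      Complex.normSq_eq_norm_sq, Complex.conj_ofReal, ← Complex.ofReal_mul, Complex.ofReal_re]
  have hsum : headSum (fun j => (inner ℂ (v j) (A.toLin (v j))).re) k
      = ∑ i, α i * ∑ j : Fin n with j.val < k, ‖inner ℂ (e i) (v j)‖ ^ 2 := by
    simp only [headSum, hq, Finset.mul_sum]
    exact Finset.sum_comm
  rw [hsum]
  refine headSum_weights_le hα
    (fun i => Finset.sum_nonneg fun j _ => by positivity) (fun i => ?_) k ?_
  · calc ∑ j : Fin n with j.val < k, ‖inner ℂ (e i) (v j)‖ ^ 2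
        ≤ ∑ j, ‖inner ℂ (e i) (v j)‖ ^ 2 :=
          Finset.sum_le_sum_of_subset_of_nonneg (Finset.filter_subset _ _)
            fun j _ _ => by positivity
      _ = 1 := by rw [v.sum_sq_norm_inner_left, e.norm_eq_one, one_pow]
  · rw [Finset.sum_comm]
    refine Finset.sum_congr rfl fun j _ => ?_
    rw [e.sum_sq_norm_inner_right, v.norm_eq_one, one_pow]

theorem re_inner_toLin_of_eigenvector (A : Herm n)
    (e : OrthonormalBasis (Fin n) ℂ (EuclideanSpace ℂ (Fin n))) {α : ℝ} {i : Fin n}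
    (h : A.toLin (e i) = (α : ℂ) • e i) : (inner ℂ (e i) (A.toLin (e i))).re = α := by
  rw [h, inner_smul_right, inner_self_eq_norm_sq_to_K, e.norm_eq_one]
  simp

/-- An orthonormal basis in which the quadratic form of `A` has the eigenvalues as values. -/
theorem exists_eigenbasis (A : Herm n) :
    ∃ v : OrthonormalBasis (Fin n) ℂ (EuclideanSpace ℂ (Fin n)),
      ∀ j, (inner ℂ (v j) (A.toLin (v j))).re = A.eigs j :=
  ⟨A.toLin_isSymmetric.eigenvectorBasis finrank_euclideanSpace_fin, fun _ =>
    re_inner_toLin_of_eigenvector A _ (A.toLin_isSymmetric.apply_eigenvectorBasis _ _)⟩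

/-- Ky Fan's inequality is used twice, each eigenbasis serving as test vectors for the other. Thus
the basis shared by a co-diagonal pair can replace the one chosen by the spectral theorem. -/
theorem headSum_eigs_of_eigenbasis (A : Herm n)
    (e : OrthonormalBasis (Fin n) ℂ (EuclideanSpace ℂ (Fin n))) {α : Fin n → ℝ}
    (hα : Antitone α) (hA : ∀ i, A.toLin (e i) = (α i : ℂ) • e i) (k : ℕ) :
    headSum A.eigs k = headSum α k := by
  apply le_antisymm
  · obtain ⟨v, hv⟩ := A.exists_eigenbasis
    simpa only [hv] using headSum_quadForm_le_of_eigenbasis A e v hα hA k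
  · simpa only [re_inner_toLin_of_eigenvector A e (hA _)] using headSum_quadForm_le A e k

theorem toLin_add_apply (A B : Herm n) (w : EuclideanSpace ℂ (Fin n)) :
    (A + B).toLin w = A.toLin w + B.toLin w := by
  simp [toLin]

theorem toLin_smul_apply (c : ℝ) (A : Herm n) (w : EuclideanSpace ℂ (Fin n)) :
    (c • A).toLin w = (c : ℂ) • A.toLin w := by
  have : ((c • A : Herm n) : Matrix (Fin n) (Fin n) ℂ)
      = (c : ℂ) • (A : Matrix (Fin n) (Fin n) ℂ) := by
    ext i j
    simp
  simp only [toLin, this, map_smul, LinearMap.smul_apply]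

/-! ### Sublinearity of the Ky Fan sums -/

theorem headSum_eigs_add_le (A B : Herm n) (k : ℕ) :
    headSum (A + B).eigs k ≤ headSum A.eigs k + headSum B.eigs k := by
  obtain ⟨v, hv⟩ := (A + B).exists_eigenbasis
  have h : (A + B).eigs = fun j => (inner ℂ (v j) (A.toLin (v j))).re
      + (inner ℂ (v j) (B.toLin (v j))).re := by
    funext j
    rw [← hv, toLin_add_apply, inner_add_right, Complex.add_re]
  rw [h, headSum_add]
  exact add_le_add (headSum_quadForm_le A v k) (headSum_quadForm_le B v k)

theorem headSum_eigs_smul_le {c : ℝ} (hc : 0 ≤ c) (A : Herm n) (k : ℕ) :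
    headSum (c • A).eigs k ≤ c * headSum A.eigs k := by
  obtain ⟨v, hv⟩ := (c • A).exists_eigenbasis
  have h : (c • A).eigs = fun j => c * (inner ℂ (v j) (A.toLin (v j))).re := by
    funext j
    rw [← hv, toLin_smul_apply, inner_smul_right, Complex.re_ofReal_mul]
  rw [h, headSum_mul_left]
  exact mul_le_mul_of_nonneg_left (headSum_quadForm_le A v k) hc

theorem headSum_eigs_smul {c : ℝ} (hc : 0 < c) (A : Herm n) (k : ℕ) :
    headSum (c • A).eigs k = c * headSum A.eigs k := by
  refine le_antisymm (headSum_eigs_smul_le hc.le A k) ?_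
  -- The reverse inequality is the same bound for the factor `c⁻¹`.
  have h := headSum_eigs_smul_le (inv_nonneg.mpr hc.le) (c • A) k
  rw [inv_smul_smul₀ hc.ne'] at h
  calc c * headSum A.eigs k ≤ c * (c⁻¹ * headSum (c • A).eigs k) :=
        mul_le_mul_of_nonneg_left h hc.le
    _ = headSum (c • A).eigs k := mul_inv_cancel_left₀ hc.ne' _

/-! ### Co-diagonal pairs -/

theorem exists_orthonormalBasis_of_unitary {U : Matrix (Fin n) (Fin n) ℂ}
    (hU : U ∈ Matrix.unitaryGroup (Fin n) ℂ) :
    ∃ e : OrthonormalBasis (Fin n) ℂ (EuclideanSpace ℂ (Fin n)),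
      ∀ i, e i = WithLp.toLp 2 (U.col i) := by
  have hon : Orthonormal ℂ fun i => (WithLp.toLp 2 (U.col i) : EuclideanSpace ℂ (Fin n)) := by
    rw [orthonormal_iff_ite]
    intro i j
    have h := congrFun₂ (Matrix.mem_unitaryGroup_iff'.mp hU) i j
    rw [Matrix.mul_apply, Matrix.one_apply] at h
    rw [← h, PiLp.inner_apply]
    refine Finset.sum_congr rfl fun l _ => ?_
    simp [Matrix.star_apply, mul_comm]
  obtain ⟨e, he⟩ := Orthonormal.exists_orthonormalBasis_extension_of_card_eq
    (ι := Fin n) (𝕜 := ℂ) finrank_euclideanSpace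
    (v := fun i => (WithLp.toLp 2 (U.col i) : EuclideanSpace ℂ (Fin n))) (s := .univ)
    (hon.comp (fun i : (Set.univ : Set (Fin n)) => i.val) Subtype.val_injective)
  exact ⟨e, fun i => he i (Set.mem_univ i)⟩

theorem toLin_col_of_conj_eq_diagonal (A : Herm n) {U : Matrix (Fin n) (Fin n) ℂ}
    (hU : U ∈ Matrix.unitaryGroup (Fin n) ℂ) {α : Fin n → ℝ}
    (h : star U * (A : Matrix (Fin n) (Fin n) ℂ) * U = Matrix.diagonal (fun i => (α i : ℂ)))
    (i : Fin n) :
    A.toLin (WithLp.toLp 2 (U.col i)) = (α i : ℂ) • WithLp.toLp 2 (U.col i) := by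
  have hAU : (A : Matrix (Fin n) (Fin n) ℂ) * U
      = U * Matrix.diagonal (fun i => (α i : ℂ)) := by
    rw [← h, ← mul_assoc, ← mul_assoc, Matrix.mem_unitaryGroup_iff.mp hU, one_mul]
  ext l
  have hl := congrFun₂ hAU l i
  rw [Matrix.mul_diagonal, Matrix.mul_apply] at hl
  simpa [toLin, Matrix.mulVec, dotProduct, mul_comm] using hl

/-- On co-diagonal pairs the Ky Fan sums are additive. -/
theorem CoDiagonal.headSum_eigs_smul_add {A B : Herm n} (h : CoDiagonal A B) {a b : ℝ}
    (ha : 0 ≤ a) (hb : 0 ≤ b) (k : ℕ) :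
    headSum (a • A + b • B).eigs k = a * headSum A.eigs k + b * headSum B.eigs k := by
  obtain ⟨U, hU, α, β, hα, hβ, hA, hB⟩ := h
  obtain ⟨e, he⟩ := exists_orthonormalBasis_of_unitary hU
  have hA' : ∀ i, A.toLin (e i) = (α i : ℂ) • e i := fun i => by
    rw [he]; exact toLin_col_of_conj_eq_diagonal A hU hA i
  have hB' : ∀ i, B.toLin (e i) = (β i : ℂ) • e i := fun i => by
    rw [he]; exact toLin_col_of_conj_eq_diagonal B hU hB i
  rw [headSum_eigs_of_eigenbasis A e hα hA', headSum_eigs_of_eigenbasis B e hβ hB',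
    -- Nonnegative coefficients keep the combined diagonal non-increasing in the common basis.
    headSum_eigs_of_eigenbasis (a • A + b • B) e (α := fun i => a * α i + b * β i)
      (fun i j hij => add_le_add (mul_le_mul_of_nonneg_left (hα hij) ha)
        (mul_le_mul_of_nonneg_left (hβ hij) hb)) (fun i => ?_),
    headSum_add, headSum_mul_left, headSum_mul_left]
  rw [toLin_add_apply, toLin_smul_apply, toLin_smul_apply, hA', hB', smul_smul, smul_smul,
    ← add_smul]
  push_cast
  rfl

/-! ### Directional derivatives at A -/

theorem tendsto_slope_headSum_delta (B A : Herm n) {k : ℕ} (hk : k ≤ n) :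
    Tendsto (fun t : ℝ => t⁻¹ * (headSum (A + t • B).eigs k - headSum A.eigs k)) (𝓝[>] 0)
      (𝓝 (headSum (delta B A) k)) := by
  have h := (hasDerivWithinAt_iff_tendsto_slope' Set.self_notMem_Ioi).mp
    (hasDerivWithinAt_headSum_delta B A hk)
  refine h.congr fun t => ?_
  simp [slope_def_module]

/-- Sublinearity bounds the directional derivative from above by increments in shifted
directions. -/
theorem headSum_delta_le (A C : Herm n) (a : ℝ) {k : ℕ} (hk : k ≤ n) :
    headSum (delta C A) k ≤ headSum (a • A + C).eigs k - a * headSum A.eigs k := by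
  refine le_of_tendsto (tendsto_slope_headSum_delta C A hk) ?_
  -- Makes the coefficient `1 - t * a` below positive, whatever the sign of `a`.
  have hsmall : ∀ᶠ t : ℝ in 𝓝[>] 0, t * a < 1 := by
    refine nhdsWithin_le_nhds (ContinuousAt.eventually_lt (by fun_prop) (by fun_prop) ?_)
    simp
  filter_upwards [hsmall, self_mem_nhdsWithin] with t hta ht
  have ht : 0 < t := ht
  have hdec : A + t • C = (1 - t * a) • A + t • (a • A + C) := by module
  have h1 := headSum_eigs_add_le ((1 - t * a) • A) (t • (a • A + C)) k
  rw [← hdec, headSum_eigs_smul (by linarith), headSum_eigs_smul ht] at h1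
  rw [inv_mul_le_iff₀ ht]
  linarith

/-- The tangent-line bound of a convex function: `headSum_delta_le` at `t⁻¹`, rescaled by `t`. -/
theorem headSum_eigs_add_smul_ge (A C : Herm n) {t : ℝ} (ht : 0 < t) {k : ℕ} (hk : k ≤ n) :
    headSum A.eigs k + t * headSum (delta C A) k ≤ headSum (A + t • C).eigs k := by
  have h := headSum_delta_le A C t⁻¹ hk
  have hdec : A + t • C = t • (t⁻¹ • A + C) := by
    rw [smul_add, smul_inv_smul₀ ht.ne']
  rw [hdec, headSum_eigs_smul ht]
  have h2 := mul_le_mul_of_nonneg_left h ht.le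
  rw [mul_sub, mul_inv_cancel_left₀ ht.ne'] at h2
  linarith

theorem le_headSum_delta_smul_add (A C : Herm n) {a : ℝ} (ha : 0 ≤ a) {k : ℕ} (hk : k ≤ n) :
    a * headSum A.eigs k + headSum (delta C A) k ≤ headSum (delta (a • A + C) A) k := by
  refine ge_of_tendsto (tendsto_slope_headSum_delta (a • A + C) A hk) ?_
  filter_upwards [self_mem_nhdsWithin] with t ht
  have ht : 0 < t := ht
  have hs : 0 < 1 + t * a := by positivity
  -- A step along `a • A + C` is, up to a positive factor, a shorter step along `C`, where the
  -- tangent-line bound applies.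
  have hdec : A + t • (a • A + C) = (1 + t * a) • (A + (t / (1 + t * a)) • C) := by
    rw [smul_add (1 + t * a), smul_smul (1 + t * a), mul_div_cancel₀ _ hs.ne']
    module
  have h := mul_le_mul_of_nonneg_left
    (headSum_eigs_add_smul_ge A C (div_pos ht hs) hk) hs.le
  rw [mul_add, ← mul_assoc, mul_div_cancel₀ _ hs.ne'] at h
  rw [hdec, headSum_eigs_smul hs, le_inv_mul_iff₀ ht]
  linarith

/-- By additivity the difference quotient is constant in t. -/
theorem CoDiagonal.headSum_delta_smul_add {A B : Herm n} (h : CoDiagonal A B) {a : ℝ}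
    (ha : 0 ≤ a) {k : ℕ} (hk : k ≤ n) :
    headSum (delta (a • A + B) A) k = a * headSum A.eigs k + headSum B.eigs k := by
  refine tendsto_nhds_unique (tendsto_slope_headSum_delta (a • A + B) A hk)
    (tendsto_const_nhds.congr' ?_)
  filter_upwards [self_mem_nhdsWithin] with t ht
  have ht : 0 < t := ht
  have hdec : A + t • (a • A + B) = (1 + t * a) • A + t • B := by module
  rw [hdec, h.headSum_eigs_smul_add (by positivity) ht.le]
  field_simp
  ring

theorem CoDiagonal.headSum_delta {A B : Herm n} (h : CoDiagonal A B) {k : ℕ} (hk : k ≤ n) :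
    headSum (delta B A) k = headSum B.eigs k := by
  simpa using h.headSum_delta_smul_add le_rfl hk

end Herm

theorem proposition3 {n : ℕ} (A B C : Herm n) (hAB : Herm.CoDiagonal A B) :
    List.TFAE [
      ∀ a : ℝ, 0 ≤ a → WeakMaj (Herm.eigs (a • A + B)) (Herm.eigs (a • A + C)),
      WeakMaj (Herm.delta B A) (Herm.delta C A),
      ∀ a : ℝ, 0 ≤ a → WeakMaj (Herm.delta (a • A + B) A) (Herm.delta (a • A + C) A)] := by
  tfae_have 1 → 2 := by
    intro h k hk1 hk
    refine le_of_tendsto_of_tendsto (Herm.tendsto_slope_headSum_delta B A hk)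
      (Herm.tendsto_slope_headSum_delta C A hk) ?_
    filter_upwards [self_mem_nhdsWithin] with t ht
    have ht : 0 < t := ht
    -- By homogeneity, small t at A corresponds to large `a = t⁻¹` in (i).
    have hdec : ∀ X : Herm n, A + t • X = t • (t⁻¹ • A + X) := fun X => by
      rw [smul_add, smul_inv_smul₀ ht.ne']
    rw [hdec B, hdec C, Herm.headSum_eigs_smul ht, Herm.headSum_eigs_smul ht]
    have := h t⁻¹ (inv_nonneg.mpr ht.le) k hk1 hk
    gcongr
  tfae_have 2 → 1 := by
    intro h a ha k hk1 hk
    have h1 := hAB.headSum_eigs_smul_add ha zero_le_one k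
    rw [one_smul, one_mul] at h1
    have h2 := h k hk1 hk
    rw [hAB.headSum_delta hk] at h2
    linarith [Herm.headSum_delta_le A C a hk]
  tfae_have 2 → 3 := by
    intro h a ha k hk1 hk
    have h2 := h k hk1 hk
    rw [hAB.headSum_delta hk] at h2
    rw [hAB.headSum_delta_smul_add ha hk]
    linarith [Herm.le_headSum_delta_smul_add A C ha hk]
  tfae_have 3 → 2 := fun h => by simpa using h 0 le_rfl
  tfae_finish
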